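/- Let $\mathbb H$ be the quaternions, and put $\operatorname{sign} a=a/|a|$ for $a\in\mathbb H\setminus\{0\}$ and $\operatorname{sign}0=0$. Let $\mathcal H$ be a right vector space over $\mathbb H$ with an $\mathbb H$-valued inner product: $\langle y,x\rangle=\overline{\langle x,y\rangle}$, $\langle z,xa+yb\rangle=\langle z,x\rangle a+\langle z,y\rangle b$ (hence $\langle xa+yb,z\rangle=\bar a\langle x,z\rangle+\bar b\langle y,z\rangle$), and $\langle x,x\rangle>0$ for $x\neq0$; let $\|x\|=\sqrt{\langle x,x\rangle}$. Let $e_1,\dots,e_n\in\mathcal H$ be an orthonormal system, and identify $z=(z_1,\dots,z_n)\in\mathbb H^n$ with the vector $\sum_i e_iz_i\in\mathcal H$. (If $\mathcal H=\mathbb H^n$ with $\langle x,y\rangle=\sum_i\bar x_iy_i$ and the standard basis, this vector is $z$ itself.) Let $$G_n^{\mathbb H}(z)=\Bigl(\frac{\pi}{2}\Bigr)^{-2n}\exp\Bigl(-2\sum_{i=1}^n|z_i|^2\Bigr)$$ be the standard quaternionic Gaussian density on $\mathbb H^n$, and let $m$ be Lebesgue measure on $\mathbb H^n=\mathbb R^{4n}$.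 Let $u,v$ be vectors of norm one in the right span of $e_1,\dots,e_n$. Then $$\int_{\mathbb H^n}\operatorname{sign}\langle u,z\rangle\,\operatorname{sign}\langle z,v\rangle\,G_n^{\mathbb H}(z)\,dm(z)=\langle u,v\rangle\,\frac32\int_0^{\pi/2}\frac{\cos^4t}{\sqrt{1-|\langle u,v\rangle|^2\sin^2t}}\,dt .$$ If moreover $\langle u,v\rangle$ is real, then also $$\int_{\mathbb H^n}\operatorname{sign}\langle z,u\rangle\,\operatorname{sign}\langle v,z\rangle\,G_n^{\mathbb H}(z)\,dm(z)=\langle u,v\rangle\,\frac32\int_0^{\pi/2}\frac{\cos^4t}{\sqrt{1-|\langle u,v\rangle|^2\sin^2t}}\,dt .$$ All integrals converge absolutely. -/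

import Mathlib

open MeasureTheory Real
open scoped Quaternion RightActions

/-- The Borel sigma-algebra on the quaternions. With it, `volume` on `ℍ[ℝ]` is Lebesgue measure on
`ℝ⁴` (normalised by the orthonormal basis `1, i, j, k`), and `volume` on `Fin n → ℍ[ℝ]` is the
product measure, i.e. Lebesgue measure on `ℝ⁴ⁿ`. -/
noncomputable instance instMeasurableSpaceQuaternionReal : MeasurableSpace ℍ[ℝ] := borel ℍ[ℝ]

instance instBorelSpaceQuaternionReal : BorelSpace ℍ[ℝ] := ⟨rfl⟩

/-- A right vector space over the quaternions (scalars `v <• a`, i.e. a module over the opposite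
ring) with a quaternion-valued inner product, conjugate-linear in the first variable and linear in
the second. By conjugate symmetry `⟨x, x⟩` is a real quaternion, so positivity is a statement about
its real part. -/
class QuaternionInnerProductSpace (V : Type*) [AddCommGroup V] [Module ℍ[ℝ]ᵐᵒᵖ V] where
  qinner : V → V → ℍ[ℝ]
  conj_symm : ∀ x y : V, qinner y x = star (qinner x y)
  left_linear : ∀ (x y z : V) (a b : ℍ[ℝ]),
    qinner (x <• a + y <• b) z = star a * qinner x z + star b * qinner y z
  right_linear : ∀ (x y z : V) (a b : ℍ[ℝ]),
    qinner z (x <• a + y <• b) = qinner z x * a + qinner z y * b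
  pos : ∀ x : V, x ≠ 0 → 0 < (qinner x x).re

/-- The quaternionic inner product `⟨x, y⟩`. -/
notation "⟪" x ", " y "⟫ℍ" => QuaternionInnerProductSpace.qinner x y

/-- The norm `‖x‖ = √⟨x, x⟩`. -/
noncomputable def qnorm {V : Type*} [AddCommGroup V] [Module ℍ[ℝ]ᵐᵒᵖ V]
    [QuaternionInnerProductSpace V] (x : V) : ℝ :=
  √(⟪x, x⟫ℍ).re

/-- `e₁, …, eₙ` is an orthonormal system: `⟨eᵢ, eⱼ⟩ = δᵢⱼ`. -/
def IsQOrthonormal {V : Type*} [AddCommGroup V] [Module ℍ[ℝ]ᵐᵒᵖ V]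
    [QuaternionInnerProductSpace V] {n : ℕ} (e : Fin n → V) : Prop :=
  ∀ i j, ⟪e i, e j⟫ℍ = if i = j then 1 else 0

/-- The vector `∑ᵢ eᵢ zᵢ` with quaternionic coordinates `z ∈ ℍⁿ` in the system `e₁, …, eₙ`. -/
noncomputable def qcombo {V : Type*} [AddCommGroup V] [Module ℍ[ℝ]ᵐᵒᵖ V] {n : ℕ}
    (e : Fin n → V) (z : Fin n → ℍ[ℝ]) : V :=
  ∑ i, e i <• z i

/-- The sign function: `sign z = z / |z|` for `z ≠ 0` and `sign 0 = 0`. -/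
noncomputable def qsign (z : ℍ[ℝ]) : ℍ[ℝ] :=
  open Classical in if z = 0 then 0 else ‖z‖⁻¹ • z

/-- The standard quaternionic Gaussian density `(π/2)^(-2n) exp(-2 ‖z‖²)` on `ℍⁿ`, where
`‖z‖² = ∑ᵢ |zᵢ|²`. -/
noncomputable def quaternionGaussian (n : ℕ) (z : Fin n → ℍ[ℝ]) : ℝ :=
  ((π / 2) ^ (2 * n))⁻¹ * Real.exp (-2 * ∑ i, ‖z i‖ ^ 2)

/-- The standard inner product `⟨x, y⟩ = ∑ᵢ x̄ᵢ yᵢ` on the right vector space `ℍⁿ`. -/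
noncomputable instance instQuaternionInnerProductSpacePi (n : ℕ) :
    QuaternionInnerProductSpace (Fin n → ℍ[ℝ]) where
  qinner x y := ∑ i, star (x i) * y i
  conj_symm x y := by simp [star_sum]
  left_linear x y z a b := by
    simp [add_mul, Finset.sum_add_distrib, Finset.mul_sum, mul_assoc]
  right_linear x y z a b := by
    simp [mul_add, Finset.sum_add_distrib, Finset.sum_mul, mul_assoc]
  pos x hx := by
    obtain ⟨i, hi⟩ := Function.ne_iff.mp hx
    have h : (∑ i, star (x i) * x i) = ((∑ i, Quaternion.normSq (x i) : ℝ) : ℍ[ℝ]) := by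
      rw [← Quaternion.algebraMap_def, map_sum]
      exact Finset.sum_congr rfl fun j _ => Quaternion.star_mul_self _
    rw [h, Quaternion.re_coe]
    refine Finset.sum_pos' (fun j _ => Quaternion.normSq_nonneg) ⟨i, Finset.mem_univ i, ?_⟩
    exact lt_of_le_of_ne Quaternion.normSq_nonneg
      (fun h0 => hi (Quaternion.normSq_eq_zero.mp h0.symm))

/-- The standard basis of `ℍⁿ` is orthonormal. -/
theorem isQOrthonormal_stdBasis (n : ℕ) :
    IsQOrthonormal (fun i : Fin n => (Pi.single i 1 : Fin n → ℍ[ℝ])) := by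
  intro i j
  change ∑ k, star ((Pi.single i 1 : Fin n → ℍ[ℝ]) k) * (Pi.single j 1 : Fin n → ℍ[ℝ]) k = _
  rw [Finset.sum_eq_single i]
  · simp [Pi.single_apply]
  · intro k _ hk
    simp [Pi.single_apply, hk]
  · simp

/-- In the standard basis of `ℍⁿ` the vector with coordinates `z` is `z` itself. -/
theorem qcombo_stdBasis (n : ℕ) (z : Fin n → ℍ[ℝ]) :
    qcombo (fun i : Fin n => (Pi.single i 1 : Fin n → ℍ[ℝ])) z = z := by
  ext1 k
  simp [qcombo, Finset.sum_apply, Pi.single_apply]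

/-!
In coordinates `u, v` become unit vectors of `ℍⁿ`. The pair `(⟨u, z⟩, ⟨v, z⟩)` is a real-linear
image of a Gaussian vector, and its characteristic function depends only on `⟨u, v⟩`
(`charFunDual_map_qinner`). Writing `⟨u, v⟩ = ω r` with `|ω| = 1` and `r` real, and putting
`s = √(1 - r²)`, the pair may therefore be replaced by `(ω a, r a + s w)` with `a, w` independent
Gaussian quaternions (`integral_quaternionGaussian_eq_integral_integral`). This also covers
`|⟨u, v⟩| = 1`, where `s = 0`.

The sign is linearised by `sign b = √(8 / π) ∫₀^∞ exp (-2 |b|² y²) b dy`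
(`integral_exp_smul_eq_qsign`). For `b = r a + s w` and fixed `y`, completing the square in `w` turns
the Gaussian average over `w` into a real multiple of `a` (`Quaternion.integral_exp_smul_add`). Hence
the average of `sign b` over `w` is a real multiple of `a`, and `sign (ω a)` times its conjugate is
a real multiple of `ω |a|`; for `ω = 1` the same holds with the conjugate taken on
the other factor. Averaging over `a` last leaves
`(3 / 2) r ∫₀^∞ (1 + y²)^(-5/2) (1 + s² y²)^(-1/2) dy`, and `y = tan t` gives the integral
over `[0, π / 2]` (`integral_exp_mul_norm_mul_integral`, `integral_Ioi_eq_integral_cos_pow_four`).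
-/

/-! ### Coordinates in an orthonormal system -/

namespace QuaternionInnerProductSpace

variable {V : Type*} [AddCommGroup V] [Module ℍ[ℝ]ᵐᵒᵖ V] [QuaternionInnerProductSpace V]

theorem qinner_smul_right (x y : V) (a : ℍ[ℝ]) : ⟪x, y <• a⟫ℍ = ⟪x, y⟫ℍ * a := by
  simpa using right_linear y 0 x a 0

theorem qinner_zero_right (x : V) : ⟪x, (0 : V)⟫ℍ = 0 := by
  simpa using qinner_smul_right x 0 0

theorem qinner_add_right (x y z : V) : ⟪x, y + z⟫ℍ = ⟪x, y⟫ℍ + ⟪x, z⟫ℍ := by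
  simpa using right_linear y z x 1 1

theorem qinner_sum_right {ι : Type*} (s : Finset ι) (x : V) (f : ι → V) :
    ⟪x, ∑ i ∈ s, f i⟫ℍ = ∑ i ∈ s, ⟪x, f i⟫ℍ := by
  classical
  induction s using Finset.induction_on with
  | empty => simp [qinner_zero_right]
  | insert i s hi ih => simp [Finset.sum_insert hi, qinner_add_right, ih]

end QuaternionInnerProductSpace

open QuaternionInnerProductSpace

theorem qinner_pi_def {n : ℕ} (x y : Fin n → ℍ[ℝ]) : ⟪x, y⟫ℍ = ∑ i, star (x i) * y i := rfl

theorem IsQOrthonormal.qinner_qcombo {V : Type*} [AddCommGroup V] [Module ℍ[ℝ]ᵐᵒᵖ V]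
    [QuaternionInnerProductSpace V] {n : ℕ} {e : Fin n → V} (he : IsQOrthonormal e)
    (x y : Fin n → ℍ[ℝ]) : ⟪qcombo e x, qcombo e y⟫ℍ = ⟪x, y⟫ℍ := by
  have h1 : ∀ i, ⟪qcombo e x, e i⟫ℍ = star (x i) := by
    intro i
    rw [conj_symm (e i), qcombo, qinner_sum_right]
    simp only [qinner_smul_right, he i, ite_mul, one_mul, zero_mul, Finset.sum_ite_eq,
      Finset.mem_univ, if_true]
  rw [qcombo.eq_1 e y, qinner_sum_right, qinner_pi_def]
  simp only [qinner_smul_right, h1]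

theorem exists_eq_qcombo_of_mem_span {V : Type*} [AddCommGroup V] [Module ℍ[ℝ]ᵐᵒᵖ V]
    {n : ℕ} {e : Fin n → V} {u : V}
    (hu : u ∈ Submodule.span ℍ[ℝ]ᵐᵒᵖ (Set.range e)) : ∃ x : Fin n → ℍ[ℝ], u = qcombo e x := by
  obtain ⟨c, hc⟩ := (Submodule.mem_span_range_iff_exists_fun _).1 hu
  exact ⟨fun i => (c i).unop, by simp [qcombo, ← hc]⟩

theorem re_qinner_self {n : ℕ} (x : Fin n → ℍ[ℝ]) : (⟪x, x⟫ℍ).re = ∑ i, ‖x i‖ ^ 2 := by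
  have h : ⟪x, x⟫ℍ = ((∑ i, ‖x i‖ ^ 2 : ℝ) : ℍ[ℝ]) := by
    rw [qinner_pi_def, ← Quaternion.algebraMap_def, map_sum]
    refine Finset.sum_congr rfl fun i _ => ?_
    rw [Quaternion.star_mul_self, Quaternion.normSq_eq_norm_mul_self, sq]
    rfl
  rw [h, Quaternion.re_coe]

theorem norm_qinner_le_one {n : ℕ} {x y : Fin n → ℍ[ℝ]} (hx : ∑ i, ‖x i‖ ^ 2 = 1)
    (hy : ∑ i, ‖y i‖ ^ 2 = 1) : ‖⟪x, y⟫ℍ‖ ≤ 1 := by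
  have h1 : ‖⟪x, y⟫ℍ‖ ≤ ∑ i, ‖x i‖ * ‖y i‖ := by
    rw [qinner_pi_def]
    refine (norm_sum_le _ _).trans_eq ?_
    simp [norm_mul]
  have h2 := Finset.sum_mul_sq_le_sq_mul_sq Finset.univ (fun i => ‖x i‖) (fun i => ‖y i‖)
  rw [hx, hy] at h2
  refine h1.trans ?_
  nlinarith

/-! ### The joint law of two linear forms of a quaternionic Gaussian vector -/

theorem Quaternion.inner_star_mul (p u z : ℍ[ℝ]) : inner ℝ p (star u * z) = inner ℝ (u * p) z := by
  simp only [Quaternion.inner_def, star_mul, star_star, Quaternion.re_mul, Quaternion.imI_mul,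
    Quaternion.imJ_mul, Quaternion.imK_mul, Quaternion.re_star, Quaternion.imI_star,
    Quaternion.imJ_star, Quaternion.imK_star]
  ring

theorem quaternionGaussian_eq_prod (n : ℕ) (z : Fin n → ℍ[ℝ]) :
    quaternionGaussian n z = ∏ i, ((π / 2) ^ 2)⁻¹ * rexp (-2 * ‖z i‖ ^ 2) := by
  rw [Finset.prod_mul_distrib, ← Real.exp_sum, quaternionGaussian, Finset.mul_sum]
  simp [pow_mul]

theorem quaternionGaussian_nonneg (n : ℕ) (z : Fin n → ℍ[ℝ]) : 0 ≤ quaternionGaussian n z := by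
  unfold quaternionGaussian
  positivity

theorem continuous_quaternionGaussian (n : ℕ) : Continuous (quaternionGaussian n) := by
  unfold quaternionGaussian
  fun_prop

theorem Quaternion.integral_exp_neg_mul_sq_norm {K : ℝ} (hK : 0 < K) :
    ∫ w : ℍ[ℝ], rexp (-K * ‖w‖ ^ 2) = (π / K) ^ 2 := by
  rw [GaussianFourier.integral_rexp_neg_mul_sq_norm hK, Quaternion.finrank_eq_four]
  norm_num

theorem Quaternion.integrable_exp_neg_mul_sq_norm {K : ℝ} (hK : 0 < K) :
    Integrable fun w : ℍ[ℝ] => rexp (-K * ‖w‖ ^ 2) := by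
  refine Integrable.of_integral_ne_zero ?_
  rw [Quaternion.integral_exp_neg_mul_sq_norm hK]
  positivity

theorem integrable_quaternionGaussian (n : ℕ) : Integrable (quaternionGaussian n) := by
  have h := Integrable.fintype_prod (𝕜 := ℝ) (ι := Fin n) (μ := fun _ => (volume : Measure ℍ[ℝ]))
    (f := fun _ w => ((π / 2) ^ 2)⁻¹ * rexp (-2 * ‖w‖ ^ 2))
    fun _ => (Quaternion.integrable_exp_neg_mul_sq_norm two_pos).const_mul _
  simp only [← quaternionGaussian_eq_prod] at h
  exact h

/-- The quaternionic Gaussian has characteristic function `t ↦ exp (-‖t‖² / 8)`: each of its `4n`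
real coordinates has variance `1 / 4`. -/
theorem integral_quaternionGaussian_mul_cexp {n : ℕ} (t : Fin n → ℍ[ℝ]) :
    ∫ z : Fin n → ℍ[ℝ], (quaternionGaussian n z : ℂ) *
      Complex.exp ((∑ i, inner ℝ (t i) (z i) : ℝ) * Complex.I) =
    Complex.exp (-(∑ i, ‖t i‖ ^ 2 : ℝ) / 8) := by
  have h1 : ∀ z : Fin n → ℍ[ℝ], (quaternionGaussian n z : ℂ) *
      Complex.exp ((∑ i, inner ℝ (t i) (z i) : ℝ) * Complex.I) =
      ∏ i, (((π : ℂ) / 2) ^ 2)⁻¹ *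
        Complex.exp (-2 * (‖z i‖ : ℂ) ^ 2 + Complex.I * (inner ℝ (t i) (z i) : ℝ)) := by
    intro z
    rw [quaternionGaussian_eq_prod]
    push_cast
    rw [Finset.sum_mul, Complex.exp_sum, ← Finset.prod_mul_distrib]
    refine Finset.prod_congr rfl fun i _ => ?_
    rw [Complex.exp_add, mul_assoc, mul_comm Complex.I]
  simp_rw [h1]
  rw [integral_fintype_prod_volume_eq_prod (f := fun i (w : ℍ[ℝ]) => (((π : ℂ) / 2) ^ 2)⁻¹ *
        Complex.exp (-2 * (‖w‖ : ℂ) ^ 2 + Complex.I * (inner ℝ (t i) w : ℝ)))]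
  have h2 : ∀ i, ∫ w : ℍ[ℝ], (((π : ℂ) / 2) ^ 2)⁻¹ *
        Complex.exp (-2 * (‖w‖ : ℂ) ^ 2 + Complex.I * (inner ℝ (t i) w : ℝ)) =
      Complex.exp (-(‖t i‖ : ℂ) ^ 2 / 8) := by
    intro i
    have hpi : (π : ℂ) ≠ 0 := by exact_mod_cast pi_ne_zero
    rw [integral_const_mul, GaussianFourier.integral_cexp_neg_mul_sq_norm_add (b := 2) (by simp),
      Quaternion.finrank_eq_four]
    have h4 : (((4 : ℕ) : ℂ) / 2) = ((2 : ℕ) : ℂ) := by norm_num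
    rw [h4, Complex.cpow_natCast, ← mul_assoc,
      inv_mul_cancel₀ (pow_ne_zero 2 (div_ne_zero hpi two_ne_zero)), one_mul, Complex.I_sq]
    congr 1
    ring
  simp_rw [h2]
  rw [← Complex.exp_sum, ← Finset.sum_div, Finset.sum_neg_distrib]
  push_cast
  rfl

theorem continuous_qinner_pi {n : ℕ} (u : Fin n → ℍ[ℝ]) :
    Continuous fun z : Fin n → ℍ[ℝ] => ⟪u, z⟫ℍ := by
  simp only [qinner_pi_def]
  fun_prop

theorem sum_norm_mul_add_mul_sq {n : ℕ} {u v : Fin n → ℍ[ℝ]} (hu : ∑ i, ‖u i‖ ^ 2 = 1)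
    (hv : ∑ i, ‖v i‖ ^ 2 = 1) (p q : ℍ[ℝ]) :
    ∑ i, ‖u i * p + v i * q‖ ^ 2 = ‖p‖ ^ 2 + 2 * inner ℝ p (⟪u, v⟫ℍ * q) + ‖q‖ ^ 2 := by
  have h : ∀ i, ‖u i * p + v i * q‖ ^ 2 =
      ‖u i‖ ^ 2 * ‖p‖ ^ 2 + 2 * inner ℝ p (star (u i) * v i * q) + ‖v i‖ ^ 2 * ‖q‖ ^ 2 := by
    intro i
    rw [norm_add_sq_real, mul_assoc (star (u i)), Quaternion.inner_star_mul, norm_mul, norm_mul,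
      mul_pow, mul_pow]
  simp_rw [h, Finset.sum_add_distrib, ← Finset.sum_mul, hu, hv, ← Finset.mul_sum, ← inner_sum,
    ← Finset.sum_mul, qinner_pi_def, one_mul]

/-- The Gaussian law on `ℍⁿ` with density `quaternionGaussian n`. -/
noncomputable def quaternionGaussianMeasure (n : ℕ) : Measure (Fin n → ℍ[ℝ]) :=
  volume.withDensity fun z => ENNReal.ofReal (quaternionGaussian n z)

instance (n : ℕ) : IsFiniteMeasure (quaternionGaussianMeasure n) :=
  isFiniteMeasure_withDensity_ofReal (integrable_quaternionGaussian n).2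

theorem integral_quaternionGaussianMeasure {E : Type*} [NormedAddCommGroup E] [NormedSpace ℝ E]
    (n : ℕ) (f : (Fin n → ℍ[ℝ]) → E) :
    ∫ z, f z ∂quaternionGaussianMeasure n = ∫ z, quaternionGaussian n z • f z := by
  rw [quaternionGaussianMeasure, integral_withDensity_eq_integral_toReal_smul
    (continuous_quaternionGaussian n).measurable.ennreal_ofReal (by simp)]
  simp_rw [ENNReal.toReal_ofReal (quaternionGaussian_nonneg n _)]

theorem charFunDual_map_qinner {n : ℕ} {u v : Fin n → ℍ[ℝ]} (hu : ∑ i, ‖u i‖ ^ 2 = 1)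
    (hv : ∑ i, ‖v i‖ ^ 2 = 1) {L : StrongDual ℝ (ℍ[ℝ] × ℍ[ℝ])} {p q : ℍ[ℝ]}
    (hL : ∀ a b : ℍ[ℝ], L (a, b) = inner ℝ p a + inner ℝ q b) :
    charFunDual ((quaternionGaussianMeasure n).map fun z => (⟪u, z⟫ℍ, ⟪v, z⟫ℍ)) L =
      Complex.exp (-(‖p‖ ^ 2 + 2 * inner ℝ p (⟪u, v⟫ℍ * q) + ‖q‖ ^ 2 : ℝ) / 8) := by
  have hsum : ∀ z : Fin n → ℍ[ℝ],
      L (⟪u, z⟫ℍ, ⟪v, z⟫ℍ) = ∑ i, inner ℝ (u i * p + v i * q) (z i) := by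
    intro z
    simp_rw [hL, qinner_pi_def, inner_sum, Quaternion.inner_star_mul, inner_add_left,
      Finset.sum_add_distrib]
  have hcont := (continuous_qinner_pi u).prodMk (continuous_qinner_pi v)
  rw [charFunDual_apply, integral_map hcont.aemeasurable (by fun_prop),
    integral_quaternionGaussianMeasure]
  simp_rw [hsum, Complex.real_smul]
  rw [integral_quaternionGaussian_mul_cexp, sum_norm_mul_add_mul_sq hu hv]

/-- The joint law of `⟨u, z⟩` and `⟨v, z⟩` under the Gaussian depends, for unit vectors `u, v`, only
on `⟨u, v⟩`. -/
theorem integral_quaternionGaussian_comp_qinner {E : Type*} [NormedAddCommGroup E]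
    [NormedSpace ℝ E] {m n : ℕ} {u v : Fin n → ℍ[ℝ]} {u' v' : Fin m → ℍ[ℝ]}
    (hu : ∑ i, ‖u i‖ ^ 2 = 1) (hv : ∑ i, ‖v i‖ ^ 2 = 1) (hu' : ∑ i, ‖u' i‖ ^ 2 = 1)
    (hv' : ∑ i, ‖v' i‖ ^ 2 = 1) (h : ⟪u, v⟫ℍ = ⟪u', v'⟫ℍ) {f : ℍ[ℝ] × ℍ[ℝ] → E}
    (hf : StronglyMeasurable f) :
    ∫ z, quaternionGaussian n z • f (⟪u, z⟫ℍ, ⟪v, z⟫ℍ) =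
      ∫ z, quaternionGaussian m z • f (⟪u', z⟫ℍ, ⟪v', z⟫ℍ) := by
  have hlaw : ((quaternionGaussianMeasure n).map fun z => (⟪u, z⟫ℍ, ⟪v, z⟫ℍ)) =
      (quaternionGaussianMeasure m).map fun z => (⟪u', z⟫ℍ, ⟪v', z⟫ℍ) := by
    refine Measure.ext_of_charFunDual (funext fun L => ?_)
    have hL : ∀ a b : ℍ[ℝ], L (a, b) =
        inner ℝ ((InnerProductSpace.toDual ℝ ℍ[ℝ]).symm (L.comp (.inl ℝ ℍ[ℝ] ℍ[ℝ]))) a +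
          inner ℝ ((InnerProductSpace.toDual ℝ ℍ[ℝ]).symm (L.comp (.inr ℝ ℍ[ℝ] ℍ[ℝ]))) b := by
      intro a b
      rw [InnerProductSpace.toDual_symm_apply, InnerProductSpace.toDual_symm_apply]
      simp [← map_add]
    rw [charFunDual_map_qinner hu hv hL, charFunDual_map_qinner hu' hv' hL, h]
  have key : ∀ {k : ℕ} (x y : Fin k → ℍ[ℝ]),
      ∫ z, quaternionGaussian k z • f (⟪x, z⟫ℍ, ⟪y, z⟫ℍ) =
        ∫ p, f p ∂((quaternionGaussianMeasure k).map fun z => (⟪x, z⟫ℍ, ⟪y, z⟫ℍ)) := by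
    intro k x y
    rw [integral_map ((continuous_qinner_pi x).prodMk (continuous_qinner_pi y)).aemeasurable
      hf.aestronglyMeasurable, integral_quaternionGaussianMeasure]
  rw [key, key, hlaw]

/-! ### Gaussian integrals over the quaternions -/

theorem Quaternion.integral_norm_mul_exp_neg_mul_sq_norm {K : ℝ} (hK : 0 < K) :
    ∫ w : ℍ[ℝ], ‖w‖ * rexp (-K * ‖w‖ ^ 2) = 3 * √π * π ^ 2 / (4 * (K ^ 2 * √K)) := by
  have h3 := integral_rpow_mul_exp_neg_mul_rpow (p := 2) (q := 3) two_pos (by norm_num) hK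
  have h4 := integral_rpow_mul_exp_neg_mul_rpow (p := 2) (q := 4) two_pos (by norm_num) hK
  have hG2 : Gamma ((3 + 1) / 2) = 1 := by norm_num
  have hG5 : Gamma ((4 + 1) / 2) = 3 * √π / 4 := by
    have := Real.Gamma_nat_add_half 2
    norm_num [Nat.doubleFactorial] at this ⊢
    exact this
  have hK2 : K ^ (-(3 + 1 : ℝ) / 2) = (K ^ 2)⁻¹ := by
    rw [show (-(3 + 1 : ℝ) / 2) = -(2 : ℕ) by norm_num, rpow_neg hK.le, rpow_natCast]
  have hK5 : K ^ (-(4 + 1 : ℝ) / 2) = (K ^ 2 * √K)⁻¹ := by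
    rw [show (-(4 + 1 : ℝ) / 2) = -((2 : ℕ) + 1 / 2) by norm_num, rpow_neg hK.le,
      rpow_add hK, rpow_natCast, sqrt_eq_rpow]
  rw [hG2, hK2] at h3
  rw [hG5, hK5] at h4
  have e3 := integral_fun_norm_addHaar (volume : Measure ℍ[ℝ]) fun ρ => rexp (-K * ρ ^ 2)
  have e4 := integral_fun_norm_addHaar (volume : Measure ℍ[ℝ]) fun ρ => ρ * rexp (-K * ρ ^ 2)
  rw [Quaternion.integral_exp_neg_mul_sq_norm hK, Quaternion.finrank_eq_four] at e3
  rw [Quaternion.finrank_eq_four] at e4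
  have i3 : ∫ ρ in Set.Ioi (0 : ℝ), ρ ^ (4 - 1) • rexp (-K * ρ ^ 2) =
      (K ^ 2)⁻¹ * (1 / 2) * 1 := by
    rw [← h3]
    refine setIntegral_congr_fun measurableSet_Ioi fun ρ _ => ?_
    norm_cast
  have i4 : ∫ ρ in Set.Ioi (0 : ℝ), ρ ^ (4 - 1) • (ρ * rexp (-K * ρ ^ 2)) =
      (K ^ 2 * √K)⁻¹ * (1 / 2) * (3 * √π / 4) := by
    rw [← h4]
    refine setIntegral_congr_fun measurableSet_Ioi fun ρ _ => ?_
    norm_cast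
    simp only [smul_eq_mul]
    ring
  rw [i3] at e3
  rw [e4, i4]
  have hsK : 0 < √K := sqrt_pos.2 hK
  simp only [smul_eq_mul, nsmul_eq_mul] at e3 ⊢
  -- the radial integral of the Gaussian itself fixes the volume of the unit ball
  have hc : (volume : Measure ℍ[ℝ]).real (Metric.ball 0 1) = π ^ 2 / 2 := by
    field_simp at e3
    push_cast at e3
    linarith
  rw [hc]
  push_cast
  field_simp
  norm_num

theorem Quaternion.integrable_norm_mul_exp_neg_mul_sq_norm {K : ℝ} (hK : 0 < K) :
    Integrable fun w : ℍ[ℝ] => ‖w‖ * rexp (-K * ‖w‖ ^ 2) := by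
  refine Integrable.of_integral_ne_zero ?_
  rw [Quaternion.integral_norm_mul_exp_neg_mul_sq_norm hK]
  positivity

theorem Quaternion.integrable_exp_neg_mul_sq_norm_smul {K : ℝ} (hK : 0 < K) :
    Integrable fun w : ℍ[ℝ] => rexp (-K * ‖w‖ ^ 2) • w := by
  refine (Quaternion.integrable_norm_mul_exp_neg_mul_sq_norm hK).mono
    (by fun_prop) (.of_forall fun w => ?_)
  simp [norm_smul, mul_comm]

theorem Quaternion.integral_exp_neg_mul_sq_norm_smul (K : ℝ) :
    ∫ w : ℍ[ℝ], rexp (-K * ‖w‖ ^ 2) • w = 0 := by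
  have h : ∫ w : ℍ[ℝ], rexp (-K * ‖w‖ ^ 2) • w = -∫ w : ℍ[ℝ], rexp (-K * ‖w‖ ^ 2) • w := by
    rw [← integral_neg, ← integral_neg_eq_self]
    simp
  rw [eq_neg_iff_add_eq_zero, ← two_smul ℝ] at h
  exact (smul_eq_zero.1 h).resolve_left two_ne_zero

/-- Integrating out `w` in a weighted linear form `r a + s w`: completing the square leaves a real
multiple of `a`. -/
theorem Quaternion.integral_exp_smul_add (r s y : ℝ) (a : ℍ[ℝ]) :
    ∫ w : ℍ[ℝ], (rexp (-2 * ‖w‖ ^ 2) * rexp (-2 * ‖r • a + s • w‖ ^ 2 * y ^ 2)) • (r • a + s • w) =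
      ((π / 2) ^ 2 * ((1 + s ^ 2 * y ^ 2) ^ 3)⁻¹ * r *
        rexp (-(2 * (r ^ 2 * y ^ 2 / (1 + s ^ 2 * y ^ 2))) * ‖a‖ ^ 2)) • a := by
  have hA : 0 < 1 + s ^ 2 * y ^ 2 := by positivity
  set A := 1 + s ^ 2 * y ^ 2 with hAdef
  rw [← integral_sub_right_eq_self _ ((y ^ 2 * r * s / A) • a)]
  have h : ∀ w : ℍ[ℝ],
      (rexp (-2 * ‖w - (y ^ 2 * r * s / A) • a‖ ^ 2) *
        rexp (-2 * ‖r • a + s • (w - (y ^ 2 * r * s / A) • a)‖ ^ 2 * y ^ 2)) •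
          (r • a + s • (w - (y ^ 2 * r * s / A) • a)) =
      rexp (-(2 * (r ^ 2 * y ^ 2 / A)) * ‖a‖ ^ 2) •
        (rexp (-(2 * A) * ‖w‖ ^ 2) • ((r / A) • a) + s • (rexp (-(2 * A) * ‖w‖ ^ 2) • w)) := by
    intro w
    have hvec : r • a + s • (w - (y ^ 2 * r * s / A) • a) = (r / A) • a + s • w := by
      have : r / A = r - s * (y ^ 2 * r * s / A) := by
        field_simp
        rw [hAdef]
        ring
      rw [this]
      module
    rw [hvec, ← Real.exp_add, smul_comm s, ← smul_add, smul_smul, ← Real.exp_add]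
    congr 2
    rw [norm_sub_sq_real, norm_add_sq_real, norm_smul, norm_smul, norm_smul, inner_smul_right,
      inner_smul_left, inner_smul_right, real_inner_comm a w, mul_pow, mul_pow, mul_pow]
    simp only [norm_eq_abs, sq_abs, conj_trivial]
    field_simp
    rw [hAdef]
    ring
  simp_rw [h]
  have h2A : 0 < 2 * A := by positivity
  have h1 : Integrable fun w : ℍ[ℝ] => rexp (-(2 * A) * ‖w‖ ^ 2) • ((r / A) • a) :=
    (Quaternion.integrable_exp_neg_mul_sq_norm h2A).smul_const _
  have h2 : Integrable fun w : ℍ[ℝ] => s • (rexp (-(2 * A) * ‖w‖ ^ 2) • w) :=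
    (Quaternion.integrable_exp_neg_mul_sq_norm_smul h2A).smul s
  rw [integral_smul, integral_add h1 h2,
    integral_smul, integral_smul_const, Quaternion.integral_exp_neg_mul_sq_norm h2A,
    Quaternion.integral_exp_neg_mul_sq_norm_smul, smul_zero, add_zero, smul_smul, smul_smul]
  congr 1
  field_simp

/-! ### The sign function -/

theorem qsign_eq_smul (z : ℍ[ℝ]) : qsign z = ‖z‖⁻¹ • z := by
  unfold qsign
  split_ifs with h <;> simp [h]

theorem measurable_qsign : Measurable qsign := by
  simp_rw [funext qsign_eq_smul]
  fun_prop

theorem norm_qsign_le_one (z : ℍ[ℝ]) : ‖qsign z‖ ≤ 1 := by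
  rw [qsign_eq_smul, norm_smul, norm_inv, norm_norm]
  exact inv_mul_le_one

theorem qsign_star (z : ℍ[ℝ]) : qsign (star z) = star (qsign z) := by
  simp [qsign_eq_smul]

theorem qsign_mul_of_norm_eq_one {ω : ℍ[ℝ]} (hω : ‖ω‖ = 1) (z : ℍ[ℝ]) :
    qsign (ω * z) = ω * qsign z := by
  simp [qsign_eq_smul, hω]

theorem qsign_mul_star_self (z : ℍ[ℝ]) : qsign z * star z = (‖z‖ : ℍ[ℝ]) := by
  by_cases h : z = 0
  · simp [qsign_eq_smul, h]
  · rw [qsign_eq_smul, smul_mul_assoc, Quaternion.self_mul_star,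
      Quaternion.normSq_eq_norm_mul_self, ← Quaternion.coe_smul, smul_eq_mul,
      inv_mul_cancel_left₀ (norm_ne_zero_iff.2 h)]

theorem star_qsign_mul_self (z : ℍ[ℝ]) : star (qsign z) * z = (‖z‖ : ℍ[ℝ]) := by
  simpa [qsign_star] using qsign_mul_star_self (star z)

/-- The sign as a superposition of Gaussian weights, since `|b|⁻¹` is a multiple of
`∫₀^∞ exp (-2 |b|² y²) dy`. At `b = 0` both sides vanish. -/
theorem integral_exp_smul_eq_qsign (b : ℍ[ℝ]) :
    ∫ y in Set.Ioi (0 : ℝ), rexp (-2 * ‖b‖ ^ 2 * y ^ 2) • b = (√(8 / π))⁻¹ • qsign b := by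
  by_cases hb : b = 0
  · simp [hb, qsign_eq_smul]
  · have hb' : 0 < ‖b‖ := norm_pos_iff.2 hb
    have h := integral_gaussian_Ioi (2 * ‖b‖ ^ 2)
    rw [integral_smul_const]
    simp only [neg_mul] at h ⊢
    rw [h, qsign_eq_smul, smul_smul]
    congr 1
    rw [sqrt_div pi_pos.le, sqrt_mul zero_le_two, sqrt_sq hb'.le, sqrt_div (by norm_num),
      show (8 : ℝ) = 2 ^ 2 * 2 by norm_num, sqrt_mul (by positivity), sqrt_sq zero_le_two]
    field_simp

/-! ### Averaging the sign -/

/-- The Gaussian average over `w` of `sign (r a + s w)` is a real multiple of `a`: Fubini's theorem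
reduces it to the weighted linear form of `Quaternion.integral_exp_smul_add`. -/
theorem Quaternion.integral_exp_smul_qsign (r s : ℝ) (a : ℍ[ℝ]) :
    ∫ w : ℍ[ℝ], rexp (-2 * ‖w‖ ^ 2) • qsign (r • a + s • w) =
      (√(8 / π) * (π / 2) ^ 2 * r * ∫ y in Set.Ioi (0 : ℝ), ((1 + s ^ 2 * y ^ 2) ^ 3)⁻¹ *
        rexp (-(2 * (r ^ 2 * y ^ 2 / (1 + s ^ 2 * y ^ 2))) * ‖a‖ ^ 2)) • a := by
  have hc : 0 < √(8 / π) := by positivity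
  have h1 : ∀ w : ℍ[ℝ], rexp (-2 * ‖w‖ ^ 2) • qsign (r • a + s • w) =
      √(8 / π) • ∫ y in Set.Ioi (0 : ℝ),
        (rexp (-2 * ‖w‖ ^ 2) * rexp (-2 * ‖r • a + s • w‖ ^ 2 * y ^ 2)) • (r • a + s • w) := by
    intro w
    simp_rw [mul_smul]
    rw [integral_smul, integral_exp_smul_eq_qsign, smul_comm, smul_inv_smul₀ hc.ne']
  have hint : Integrable (Function.uncurry fun (w : ℍ[ℝ]) (y : ℝ) =>
      (rexp (-2 * ‖w‖ ^ 2) * rexp (-2 * ‖r • a + s • w‖ ^ 2 * y ^ 2)) • (r • a + s • w))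
      (volume.prod (volume.restrict (Set.Ioi (0 : ℝ)))) := by
    have hmeas : AEStronglyMeasurable (Function.uncurry fun (w : ℍ[ℝ]) (y : ℝ) =>
      (rexp (-2 * ‖w‖ ^ 2) * rexp (-2 * ‖r • a + s • w‖ ^ 2 * y ^ 2)) • (r • a + s • w))
      (volume.prod (volume.restrict (Set.Ioi (0 : ℝ)))) := by
      unfold Function.uncurry
      fun_prop
    rw [integrable_prod_iff hmeas]
    refine ⟨.of_forall fun w => ?_, ?_⟩
    · simp only [Function.uncurry]
      by_cases hb : r • a + s • w = 0
      · simp [hb]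
      · have hb' : 0 < 2 * ‖r • a + s • w‖ ^ 2 := by positivity
        have := (((integrable_exp_neg_mul_sq hb').integrableOn (s := Set.Ioi 0)).const_mul
          (rexp (-2 * ‖w‖ ^ 2))).smul_const (r • a + s • w)
        simpa only [neg_mul] using this
    · have h2 : ∀ w : ℍ[ℝ], ∫ y in Set.Ioi (0 : ℝ), ‖Function.uncurry (fun (w : ℍ[ℝ]) (y : ℝ) =>
          (rexp (-2 * ‖w‖ ^ 2) * rexp (-2 * ‖r • a + s • w‖ ^ 2 * y ^ 2)) • (r • a + s • w))
            (w, y)‖ = rexp (-2 * ‖w‖ ^ 2) * ‖(√(8 / π))⁻¹ • qsign (r • a + s • w)‖ := by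
        intro w
        rw [← integral_exp_smul_eq_qsign, integral_smul_const, norm_smul, norm_of_nonneg
          (setIntegral_nonneg measurableSet_Ioi fun y _ => (exp_pos _).le),
          ← integral_mul_const, ← integral_const_mul]
        refine integral_congr_ae (.of_forall fun y => ?_)
        simp only [Function.uncurry]
        rw [norm_smul, norm_of_nonneg (by positivity), mul_assoc]
      have hq : Measurable fun w : ℍ[ℝ] => qsign (r • a + s • w) :=
        measurable_qsign.comp (by fun_prop)
      simp_rw [h2]
      refine (Quaternion.integrable_exp_neg_mul_sq_norm two_pos).mul_bdd (c := (√(8 / π))⁻¹)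
        (hq.const_smul (√(8 / π))⁻¹).norm.aestronglyMeasurable (.of_forall fun w => ?_)
      rw [norm_norm, norm_smul, norm_of_nonneg (by positivity)]
      exact mul_le_of_le_one_right (by positivity) (norm_qsign_le_one _)
  simp_rw [h1]
  rw [integral_smul, integral_integral_swap hint]
  simp_rw [Quaternion.integral_exp_smul_add]
  have h3 : ∀ y : ℝ, (π / 2) ^ 2 * ((1 + s ^ 2 * y ^ 2) ^ 3)⁻¹ * r *
      rexp (-(2 * (r ^ 2 * y ^ 2 / (1 + s ^ 2 * y ^ 2))) * ‖a‖ ^ 2) =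
      (π / 2) ^ 2 * r * (((1 + s ^ 2 * y ^ 2) ^ 3)⁻¹ *
        rexp (-(2 * (r ^ 2 * y ^ 2 / (1 + s ^ 2 * y ^ 2))) * ‖a‖ ^ 2)) := fun y => by ring
  simp_rw [h3]
  rw [integral_smul_const, integral_const_mul, smul_smul]
  simp only [mul_assoc]

/-- The integral over the half-line and the one over `[0, π / 2]` correspond under `y = tan t`. -/
theorem integral_Ioi_eq_integral_cos_pow_four {r s : ℝ} (hrs : r ^ 2 + s ^ 2 = 1) :
    ∫ y in Set.Ioi (0 : ℝ), ((1 + y ^ 2) ^ 2 * √(1 + y ^ 2) * √(1 + s ^ 2 * y ^ 2))⁻¹ =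
      ∫ t in (0 : ℝ)..(π / 2), cos t ^ 4 / √(1 - r ^ 2 * sin t ^ 2) := by
  have hcos : ∀ t ∈ Set.Ioo (0 : ℝ) (π / 2), 0 < cos t := fun t ht =>
    cos_pos_of_mem_Ioo ⟨by linarith [ht.1, pi_pos], ht.2⟩
  have himg : tan '' Set.Ioo 0 (π / 2) = Set.Ioi 0 := by
    ext y
    constructor
    · rintro ⟨t, ht, rfl⟩
      exact tan_pos_of_pos_of_lt_pi_div_two ht.1 ht.2
    · intro hy
      exact ⟨arctan y, ⟨arctan_pos.2 hy, arctan_lt_pi_div_two y⟩, tan_arctan y⟩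
  have hinj : Set.InjOn tan (Set.Ioo 0 (π / 2)) := injOn_tan.mono
    (Set.Ioo_subset_Ioo_left (by linarith [pi_pos]))
  rw [← himg, integral_image_eq_integral_abs_deriv_smul measurableSet_Ioo
    (fun t ht => (hasDerivAt_tan (hcos t ht).ne').hasDerivWithinAt) hinj,
    intervalIntegral.integral_of_le (by positivity), integral_Ioc_eq_integral_Ioo]
  refine setIntegral_congr_fun measurableSet_Ioo fun t ht => ?_
  have hc := hcos t ht
  have h1 : 1 + tan t ^ 2 = (cos t ^ 2)⁻¹ := by
    rw [← inv_one_add_tan_sq hc.ne', inv_inv]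
  have h2 : 1 + s ^ 2 * tan t ^ 2 = (1 - r ^ 2 * sin t ^ 2) / cos t ^ 2 := by
    rw [tan_eq_sin_div_cos]
    field_simp
    linear_combination sin t ^ 2 * hrs + sin_sq_add_cos_sq t
  have h3 : √(cos t ^ 2)⁻¹ = (cos t)⁻¹ := by rw [sqrt_inv, sqrt_sq hc.le]
  simp only [smul_eq_mul]
  rw [h1, h2, h3, sqrt_div' _ (by positivity), sqrt_sq hc.le, abs_of_pos (by positivity)]
  simp only [mul_inv, inv_div, inv_inv, inv_pow]
  field_simp

theorem intervalIntegrable_cos_pow_four_div {r : ℝ} (hr : r ^ 2 ≤ 1) :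
    IntervalIntegrable (fun t : ℝ => cos t ^ 4 / √(1 - r ^ 2 * sin t ^ 2)) volume 0 (π / 2) := by
  rw [intervalIntegrable_iff]
  refine Measure.integrableOn_of_bounded (M := 1) (by simp)
    (by fun_prop : Measurable _).aestronglyMeasurable (.of_forall fun t => ?_)
  -- the denominator may vanish at `t = π / 2`, but it dominates `|cos t|`
  have h1 : |cos t| ≤ √(1 - r ^ 2 * sin t ^ 2) := by
    rw [← sqrt_sq_eq_abs]
    refine sqrt_le_sqrt ?_
    nlinarith [sin_sq_add_cos_sq t, sq_nonneg (sin t)]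
  rw [norm_div, norm_pow, norm_eq_abs, norm_of_nonneg (sqrt_nonneg _)]
  refine div_le_one_of_le₀ (le_trans ?_ h1) (sqrt_nonneg _)
  exact pow_le_of_le_one (abs_nonneg _) (abs_cos_le_one t) (by norm_num)

/-- The remaining average over `a`, with the order of integration exchanged: the integral over `a`
is a first absolute moment of a Gaussian of precision proportional to
`(1 + y²) / (1 + s² y²)`. -/
theorem integral_exp_mul_norm_mul_integral {r s : ℝ} (hrs : r ^ 2 + s ^ 2 = 1) :
    ∫ a : ℍ[ℝ], rexp (-2 * ‖a‖ ^ 2) * (‖a‖ * ∫ y in Set.Ioi (0 : ℝ),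
        ((1 + s ^ 2 * y ^ 2) ^ 3)⁻¹ *
          rexp (-(2 * (r ^ 2 * y ^ 2 / (1 + s ^ 2 * y ^ 2))) * ‖a‖ ^ 2)) =
      3 * √π * π ^ 2 / (16 * √2) *
        ∫ t in (0 : ℝ)..(π / 2), cos t ^ 4 / √(1 - r ^ 2 * sin t ^ 2) := by
  set K : ℝ → ℝ := fun y => 2 * ((1 + y ^ 2) / (1 + s ^ 2 * y ^ 2)) with hK
  have hKpos : ∀ y, 0 < K y := fun y => by positivity
  have h1 : ∀ (a : ℍ[ℝ]) (y : ℝ), rexp (-2 * ‖a‖ ^ 2) * (‖a‖ * (((1 + s ^ 2 * y ^ 2) ^ 3)⁻¹ *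
      rexp (-(2 * (r ^ 2 * y ^ 2 / (1 + s ^ 2 * y ^ 2))) * ‖a‖ ^ 2))) =
      ((1 + s ^ 2 * y ^ 2) ^ 3)⁻¹ * (‖a‖ * rexp (-K y * ‖a‖ ^ 2)) := by
    intro a y
    have hA : 0 < 1 + s ^ 2 * y ^ 2 := by positivity
    have : -K y * ‖a‖ ^ 2 = -2 * ‖a‖ ^ 2 +
        -(2 * (r ^ 2 * y ^ 2 / (1 + s ^ 2 * y ^ 2))) * ‖a‖ ^ 2 := by
      simp only [hK]
      field_simp
      linear_combination y ^ 2 * ‖a‖ ^ 2 * hrs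
    rw [this, Real.exp_add]
    ring
  have h2 : ∀ y : ℝ, ∫ a : ℍ[ℝ], ((1 + s ^ 2 * y ^ 2) ^ 3)⁻¹ * (‖a‖ * rexp (-K y * ‖a‖ ^ 2)) =
      3 * √π * π ^ 2 / (16 * √2) *
        ((1 + y ^ 2) ^ 2 * √(1 + y ^ 2) * √(1 + s ^ 2 * y ^ 2))⁻¹ := by
    intro y
    have hA : 0 < 1 + s ^ 2 * y ^ 2 := by positivity
    have hsA : 0 < √(1 + s ^ 2 * y ^ 2) := sqrt_pos.2 hA
    have hsq : √(1 + s ^ 2 * y ^ 2) ^ 2 = 1 + s ^ 2 * y ^ 2 := sq_sqrt hA.le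
    have hB : 0 < √(1 + y ^ 2) := sqrt_pos.2 (by positivity)
    rw [integral_const_mul, Quaternion.integral_norm_mul_exp_neg_mul_sq_norm (hKpos y)]
    simp only [hK]
    rw [sqrt_mul zero_le_two, sqrt_div (by positivity)]
    generalize √(1 + s ^ 2 * y ^ 2) = q at *
    rw [← hsq]
    field_simp
    norm_num
  have hint : Integrable (Function.uncurry fun (a : ℍ[ℝ]) (y : ℝ) =>
      ((1 + s ^ 2 * y ^ 2) ^ 3)⁻¹ * (‖a‖ * rexp (-K y * ‖a‖ ^ 2)))
      (volume.prod (volume.restrict (Set.Ioi (0 : ℝ)))) := by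
    have hmeas : Measurable (Function.uncurry fun (a : ℍ[ℝ]) (y : ℝ) =>
      ((1 + s ^ 2 * y ^ 2) ^ 3)⁻¹ * (‖a‖ * rexp (-K y * ‖a‖ ^ 2))) := by
      unfold Function.uncurry
      fun_prop
    rw [integrable_prod_iff' hmeas.aestronglyMeasurable]
    refine ⟨.of_forall fun y => by
      simpa only [Function.uncurry] using
        (Quaternion.integrable_norm_mul_exp_neg_mul_sq_norm (hKpos y)).const_mul _, ?_⟩
    have h3 : ∀ (y : ℝ) (a : ℍ[ℝ]), ‖Function.uncurry (fun (a : ℍ[ℝ]) (y : ℝ) =>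
        ((1 + s ^ 2 * y ^ 2) ^ 3)⁻¹ * (‖a‖ * rexp (-K y * ‖a‖ ^ 2))) (a, y)‖ =
        ((1 + s ^ 2 * y ^ 2) ^ 3)⁻¹ * (‖a‖ * rexp (-K y * ‖a‖ ^ 2)) := fun y a =>
      norm_of_nonneg (by simp only [Function.uncurry]; positivity)
    simp_rw [h3, h2]
    refine (integrable_inv_one_add_sq.restrict.mono (by fun_prop)
      (.of_forall fun y => ?_)).const_mul _
    rw [norm_of_nonneg (by positivity), norm_of_nonneg (by positivity)]
    refine inv_anti₀ (by positivity) ?_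
    have e1 : 1 ≤ 1 + y ^ 2 := by nlinarith [sq_nonneg y]
    have e2 : 1 ≤ √(1 + y ^ 2) := one_le_sqrt.2 e1
    have e3 : 1 ≤ √(1 + s ^ 2 * y ^ 2) := one_le_sqrt.2 (by nlinarith [sq_nonneg (s * y)])
    calc 1 + y ^ 2 ≤ (1 + y ^ 2) ^ 2 := le_self_pow₀ e1 two_ne_zero
      _ ≤ (1 + y ^ 2) ^ 2 * √(1 + y ^ 2) := le_mul_of_one_le_right (by positivity) e2
      _ ≤ _ := le_mul_of_one_le_right (by positivity) e3
  simp_rw [← integral_const_mul, h1]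
  rw [integral_integral_swap hint]
  simp_rw [h2]
  rw [integral_const_mul, integral_Ioi_eq_integral_cos_pow_four hrs]

/-! ### Reduction to two quaternionic variables -/

theorem Quaternion.integrable_exp_smul_qsign (r s : ℝ) (a : ℍ[ℝ]) :
    Integrable fun w : ℍ[ℝ] => rexp (-2 * ‖w‖ ^ 2) • qsign (r • a + s • w) :=
  (Quaternion.integrable_exp_neg_mul_sq_norm two_pos).smul_bdd 1
    (measurable_qsign.comp (by fun_prop)).aestronglyMeasurable
    (.of_forall fun _ => norm_qsign_le_one _)

theorem integrable_quaternionGaussian_smul {n : ℕ} {f : (Fin n → ℍ[ℝ]) → ℍ[ℝ]}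
    (hf : Measurable f) (hf1 : ∀ z, ‖f z‖ ≤ 1) :
    Integrable fun z => quaternionGaussian n z • f z :=
  (integrable_quaternionGaussian n).smul_bdd 1 hf.aestronglyMeasurable (.of_forall hf1)

/-- Vectors `u, v` with `⟨u, v⟩ = ω r` may be replaced by vectors of `ℍ²`: the pair
`(⟨u, z⟩, ⟨v, z⟩)` is distributed as `(ω a, r a + √(1 - r²) w)` with `a, w` independent. -/
theorem integral_quaternionGaussian_eq_integral_integral {n : ℕ} {u v : Fin n → ℍ[ℝ]}
    (hu : ∑ i, ‖u i‖ ^ 2 = 1) (hv : ∑ i, ‖v i‖ ^ 2 = 1) {ω : ℍ[ℝ]} (hω : ‖ω‖ = 1) {r s : ℝ}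
    (hrs : r ^ 2 + s ^ 2 = 1) (huv : ⟪u, v⟫ℍ = ω * (r : ℍ[ℝ])) {f : ℍ[ℝ] × ℍ[ℝ] → ℍ[ℝ]}
    (hf : Measurable f) (hf1 : ∀ p, ‖f p‖ ≤ 1) :
    ∫ z, quaternionGaussian n z • f (⟪u, z⟫ℍ, ⟪v, z⟫ℍ) =
      ((π / 2) ^ 4)⁻¹ • ∫ a : ℍ[ℝ], rexp (-2 * ‖a‖ ^ 2) •
        ∫ w : ℍ[ℝ], rexp (-2 * ‖w‖ ^ 2) • f (ω * a, r • a + s • w) := by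
  have hu' : ∑ i, ‖(![star ω, 0] : Fin 2 → ℍ[ℝ]) i‖ ^ 2 = 1 := by simp [hω]
  have hv' : ∑ i, ‖(![(r : ℍ[ℝ]), (s : ℍ[ℝ])] : Fin 2 → ℍ[ℝ]) i‖ ^ 2 = 1 := by
    simp [Quaternion.norm_coe, hrs]
  have huv' : ⟪u, v⟫ℍ = ⟪(![star ω, 0] : Fin 2 → ℍ[ℝ]), ![(r : ℍ[ℝ]), (s : ℍ[ℝ])]⟫ℍ := by
    simp [huv, qinner_pi_def]
  rw [integral_quaternionGaussian_comp_qinner hu hv hu' hv' huv' hf.stronglyMeasurable]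
  set g : ℍ[ℝ] × ℍ[ℝ] → ℍ[ℝ] := fun p => ((π / 2) ^ 4)⁻¹ •
    ((rexp (-2 * ‖p.1‖ ^ 2) * rexp (-2 * ‖p.2‖ ^ 2)) • f (ω * p.1, r • p.1 + s • p.2)) with hg
  have h1 : ∀ z : Fin 2 → ℍ[ℝ], quaternionGaussian 2 z •
      f (⟪![star ω, 0], z⟫ℍ, ⟪![(r : ℍ[ℝ]), (s : ℍ[ℝ])], z⟫ℍ) =
        g (MeasurableEquiv.finTwoArrow z) := by
    intro z
    have e1 : quaternionGaussian 2 z =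
        ((π / 2) ^ 4)⁻¹ * (rexp (-2 * ‖z 0‖ ^ 2) * rexp (-2 * ‖z 1‖ ^ 2)) := by
      rw [quaternionGaussian, ← Real.exp_add, Fin.sum_univ_two, mul_add]
    have e2 : ⟪(![star ω, 0] : Fin 2 → ℍ[ℝ]), z⟫ℍ = ω * z 0 := by simp [qinner_pi_def]
    have e3 : ⟪![(r : ℍ[ℝ]), (s : ℍ[ℝ])], z⟫ℍ = r • z 0 + s • z 1 := by
      simp [qinner_pi_def, Quaternion.coe_mul_eq_smul]
    rw [e1, e2, e3, mul_smul]
    rfl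
  rw [integral_congr_ae (.of_forall h1),
    (volume_preserving_finTwoArrow ℍ[ℝ]).integral_comp' g, hg, integral_smul,
    Measure.volume_eq_prod, integral_prod]
  · simp_rw [mul_smul, integral_smul]
  · exact ((Quaternion.integrable_exp_neg_mul_sq_norm two_pos).mul_prod
      (Quaternion.integrable_exp_neg_mul_sq_norm two_pos)).smul_bdd 1
      (hf.comp (by fun_prop)).aestronglyMeasurable (.of_forall fun _ => hf1 _)

/-- The Gaussian average of `φ_a (sign (r a + s w))` for real-linear maps `φ_a` with
`φ_a a = |a| ω`. As the average of the sign over `w` is a real multiple of `a`, only the value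
`φ_a a` matters; this covers both orders of the factors in a product of signs. -/
theorem integral_integral_clm_qsign {r s : ℝ} (hrs : r ^ 2 + s ^ 2 = 1)
    (φ : ℍ[ℝ] → ℍ[ℝ] →L[ℝ] ℍ[ℝ]) (ω : ℍ[ℝ]) (hφ : ∀ a, φ a a = ‖a‖ • ω) :
    ((π / 2) ^ 4)⁻¹ • ∫ a : ℍ[ℝ], rexp (-2 * ‖a‖ ^ 2) •
        ∫ w : ℍ[ℝ], rexp (-2 * ‖w‖ ^ 2) • φ a (qsign (r • a + s • w)) =
      ω * (r : ℍ[ℝ]) * ((3 / 2 * ∫ t in (0 : ℝ)..(π / 2),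
        cos t ^ 4 / √(1 - r ^ 2 * sin t ^ 2) : ℝ) : ℍ[ℝ]) := by
  have h1 : ∀ a : ℍ[ℝ], rexp (-2 * ‖a‖ ^ 2) •
      ∫ w : ℍ[ℝ], rexp (-2 * ‖w‖ ^ 2) • φ a (qsign (r • a + s • w)) =
      (√(8 / π) * (π / 2) ^ 2 * r * (rexp (-2 * ‖a‖ ^ 2) * (‖a‖ * ∫ y in Set.Ioi (0 : ℝ),
        ((1 + s ^ 2 * y ^ 2) ^ 3)⁻¹ *
          rexp (-(2 * (r ^ 2 * y ^ 2 / (1 + s ^ 2 * y ^ 2))) * ‖a‖ ^ 2)))) • ω := by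
    intro a
    simp_rw [← map_smul]
    rw [(φ a).integral_comp_comm (Quaternion.integrable_exp_smul_qsign r s a),
      Quaternion.integral_exp_smul_qsign, map_smul, hφ, smul_smul, smul_smul]
    congr 1
    ring
  simp_rw [h1]
  rw [integral_smul_const, integral_const_mul, integral_exp_mul_norm_mul_integral hrs, smul_smul,
    mul_assoc ω, ← Quaternion.coe_mul, ← Quaternion.coe_commutes, Quaternion.coe_mul_eq_smul]
  congr 1
  rw [sqrt_div (by norm_num), show (8 : ℝ) = 2 ^ 2 * 2 by norm_num, sqrt_mul (by positivity),
    sqrt_sq zero_le_two]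
  generalize (∫ t in (0 : ℝ)..(π / 2), cos t ^ 4 / √(1 - r ^ 2 * sin t ^ 2)) = J
  field_simp
  ring

theorem integral_qsign_qinner_mul_qsign_qinner {n : ℕ} {u v : Fin n → ℍ[ℝ]}
    (hu : ∑ i, ‖u i‖ ^ 2 = 1) (hv : ∑ i, ‖v i‖ ^ 2 = 1) :
    ∫ z, quaternionGaussian n z • (qsign ⟪u, z⟫ℍ * star (qsign ⟪v, z⟫ℍ)) =
      ⟪u, v⟫ℍ * ((3 / 2 * ∫ t in (0 : ℝ)..(π / 2),
        cos t ^ 4 / √(1 - ‖⟪u, v⟫ℍ‖ ^ 2 * sin t ^ 2) : ℝ) : ℍ[ℝ]) := by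
  obtain ⟨ω, hω, h⟩ : ∃ ω : ℍ[ℝ], ‖ω‖ = 1 ∧ ⟪u, v⟫ℍ = ω * (‖⟪u, v⟫ℍ‖ : ℍ[ℝ]) := by
    by_cases hc : ⟪u, v⟫ℍ = 0
    -- for `⟨u, v⟩ = 0` any unit quaternion serves as its direction
    · exact ⟨1, by simp, by simp [hc]⟩
    · have hc' := norm_ne_zero_iff.2 hc
      refine ⟨‖⟪u, v⟫ℍ‖⁻¹ • ⟪u, v⟫ℍ, by simp [norm_smul, hc'], ?_⟩
      rw [← Quaternion.coe_commutes, Quaternion.coe_mul_eq_smul, smul_inv_smul₀ hc']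
  have hle := norm_qinner_le_one hu hv
  have hrs : ‖⟪u, v⟫ℍ‖ ^ 2 + √(1 - ‖⟪u, v⟫ℍ‖ ^ 2) ^ 2 = 1 := by
    rw [sq_sqrt (by nlinarith [norm_nonneg ⟪u, v⟫ℍ])]
    ring
  have hstar : Continuous (star : ℍ[ℝ] → ℍ[ℝ]) := continuous_star
  rw [integral_quaternionGaussian_eq_integral_integral hu hv hω hrs h
    (f := fun p => qsign p.1 * star (qsign p.2))
    ((measurable_qsign.comp measurable_fst).mul
      (hstar.measurable.comp (measurable_qsign.comp measurable_snd)))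
    fun p => by
      rw [norm_mul, norm_star]
      exact mul_le_one₀ (norm_qsign_le_one _) (norm_nonneg _) (norm_qsign_le_one _)]
  have : StarModule ℝ ℍ[ℝ] := ⟨fun t a => by simp⟩
  have key := integral_integral_clm_qsign hrs
    (fun a => (ContinuousLinearMap.mul ℝ ℍ[ℝ] (qsign (ω * a))).comp
      (starL' ℝ : ℍ[ℝ] ≃L[ℝ] ℍ[ℝ]).toContinuousLinearMap) ω fun a => by
        change qsign (ω * a) * star a = _
        rw [qsign_mul_of_norm_eq_one hω, mul_assoc, qsign_mul_star_self,
          ← Quaternion.coe_commutes, Quaternion.coe_mul_eq_smul]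
  rw [← h] at key
  rw [← key]
  rfl

theorem integral_star_qsign_qinner_mul_qsign_qinner {n : ℕ} {u v : Fin n → ℍ[ℝ]}
    (hu : ∑ i, ‖u i‖ ^ 2 = 1) (hv : ∑ i, ‖v i‖ ^ 2 = 1) {r : ℝ} (h : ⟪u, v⟫ℍ = (r : ℍ[ℝ])) :
    ∫ z, quaternionGaussian n z • (star (qsign ⟪u, z⟫ℍ) * qsign ⟪v, z⟫ℍ) =
      ⟪u, v⟫ℍ * ((3 / 2 * ∫ t in (0 : ℝ)..(π / 2),
        cos t ^ 4 / √(1 - ‖⟪u, v⟫ℍ‖ ^ 2 * sin t ^ 2) : ℝ) : ℍ[ℝ]) := by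
  have hr : ‖⟪u, v⟫ℍ‖ ^ 2 = r ^ 2 := by rw [h, Quaternion.norm_coe, norm_eq_abs, sq_abs]
  have hle := norm_qinner_le_one hu hv
  have hrs : r ^ 2 + √(1 - r ^ 2) ^ 2 = 1 := by
    rw [sq_sqrt (by nlinarith [norm_nonneg ⟪u, v⟫ℍ])]
    ring
  have hstar : Continuous (star : ℍ[ℝ] → ℍ[ℝ]) := continuous_star
  rw [hr, integral_quaternionGaussian_eq_integral_integral hu hv norm_one hrs
    (by rw [h, one_mul]) (f := fun p => star (qsign p.1) * qsign p.2)
    ((hstar.measurable.comp (measurable_qsign.comp measurable_fst)).mul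
      (measurable_qsign.comp measurable_snd))
    fun p => by
      rw [norm_mul, norm_star]
      exact mul_le_one₀ (norm_qsign_le_one _) (norm_nonneg _) (norm_qsign_le_one _)]
  have key := integral_integral_clm_qsign hrs
    (fun a => ContinuousLinearMap.mul ℝ ℍ[ℝ] (star (qsign a))) 1 fun a => by
      rw [ContinuousLinearMap.mul_apply', star_qsign_mul_self, ← Quaternion.coe_mul_eq_smul,
        mul_one]
  rw [h]
  simp only [one_mul] at key ⊢
  exact key

/-! ### The sign correlation in an orthonormal system -/

theorem mainTheorem4 {ℋ : Type*} [AddCommGroup ℋ] [Module ℍ[ℝ]ᵐᵒᵖ ℋ]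
    [QuaternionInnerProductSpace ℋ] (n : ℕ) (e : Fin n → ℋ) (he : IsQOrthonormal e) (u v : ℋ)
    (hu : u ∈ Submodule.span ℍ[ℝ]ᵐᵒᵖ (Set.range e)) (hv : v ∈ Submodule.span ℍ[ℝ]ᵐᵒᵖ (Set.range e))
    (hu1 : qnorm u = 1) (hv1 : qnorm v = 1) :
    IntervalIntegrable
        (fun t : ℝ => Real.cos t ^ 4 / √(1 - ‖⟪u, v⟫ℍ‖ ^ 2 * Real.sin t ^ 2)) volume 0 (π / 2) ∧
    (Integrable (fun z : Fin n → ℍ[ℝ] =>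
        quaternionGaussian n z • (qsign ⟪u, qcombo e z⟫ℍ * qsign ⟪qcombo e z, v⟫ℍ)) ∧
      ∫ z : Fin n → ℍ[ℝ],
          quaternionGaussian n z • (qsign ⟪u, qcombo e z⟫ℍ * qsign ⟪qcombo e z, v⟫ℍ) =
        ⟪u, v⟫ℍ * ((3 / 2 * ∫ t in (0 : ℝ)..(π / 2),
          Real.cos t ^ 4 / √(1 - ‖⟪u, v⟫ℍ‖ ^ 2 * Real.sin t ^ 2) : ℝ) : ℍ[ℝ])) ∧
    ((∃ r : ℝ, ⟪u, v⟫ℍ = (r : ℍ[ℝ])) →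
      Integrable (fun z : Fin n → ℍ[ℝ] =>
        quaternionGaussian n z • (qsign ⟪qcombo e z, u⟫ℍ * qsign ⟪v, qcombo e z⟫ℍ)) ∧
      ∫ z : Fin n → ℍ[ℝ],
          quaternionGaussian n z • (qsign ⟪qcombo e z, u⟫ℍ * qsign ⟪v, qcombo e z⟫ℍ) =
        ⟪u, v⟫ℍ * ((3 / 2 * ∫ t in (0 : ℝ)..(π / 2),
          Real.cos t ^ 4 / √(1 - ‖⟪u, v⟫ℍ‖ ^ 2 * Real.sin t ^ 2) : ℝ) : ℍ[ℝ])) := by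
  obtain ⟨x, rfl⟩ := exists_eq_qcombo_of_mem_span hu
  obtain ⟨y, rfl⟩ := exists_eq_qcombo_of_mem_span hv
  have hnorm : ∀ w : Fin n → ℍ[ℝ], qnorm (qcombo e w) = 1 → ∑ i, ‖w i‖ ^ 2 = 1 := by
    intro w hw
    rwa [qnorm, sqrt_eq_one, he.qinner_qcombo, re_qinner_self] at hw
  have hx := hnorm x hu1
  have hy := hnorm y hv1
  have hswap : ∀ a b : Fin n → ℍ[ℝ], qsign ⟪a, b⟫ℍ = star (qsign ⟪b, a⟫ℍ) := by
    intro a b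
    rw [QuaternionInnerProductSpace.conj_symm b a, qsign_star]
  have hmeas : ∀ a : Fin n → ℍ[ℝ], Measurable fun z => qsign ⟪a, z⟫ℍ := fun a =>
    measurable_qsign.comp (continuous_qinner_pi a).measurable
  have hstar : Continuous (star : ℍ[ℝ] → ℍ[ℝ]) := continuous_star
  have hbound : ∀ a b : ℍ[ℝ], ‖qsign a‖ * ‖qsign b‖ ≤ 1 := fun a b =>
    mul_le_one₀ (norm_qsign_le_one _) (norm_nonneg _) (norm_qsign_le_one _)
  simp only [he.qinner_qcombo]
  simp only [hswap _ y, hswap _ x]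
  refine ⟨intervalIntegrable_cos_pow_four_div
      (pow_le_one₀ (norm_nonneg _) (norm_qinner_le_one hx hy)), ⟨?_, ?_⟩, ?_⟩
  · refine integrable_quaternionGaussian_smul
      ((hmeas x).mul (hstar.measurable.comp (hmeas y))) fun z => ?_
    rw [norm_mul, norm_star]
    exact hbound _ _
  · exact integral_qsign_qinner_mul_qsign_qinner hx hy
  · rintro ⟨r, hr⟩
    refine ⟨?_, integral_star_qsign_qinner_mul_qsign_qinner hx hy hr⟩
    refine integrable_quaternionGaussian_smul
      ((hstar.measurable.comp (hmeas x)).mul (hmeas y)) fun z => ?_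
    rw [norm_mul, norm_star]
    exact hbound _ _
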